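/- Let $\Sigma$ be a finite alphabet with at least two letters. A quantum automaton over $\Sigma$ is a tuple $\mathcal A=(\mathcal H,|s_0\rangle,\Sigma,\{U_\sigma\}_{\sigma\in\Sigma},F)$ with $\mathcal H$ a finite-dimensional complex Hilbert space, $|s_0\rangle\in\mathcal H$ a unit vector, every $U_\sigma$ a unitary operator on $\mathcal H$, and $F\subseteq\mathcal H$ a linear subspace. For an infinite word $w=\sigma_1\sigma_2\cdots\in\Sigma^\omega$, a unit vector $|\psi\rangle\in F$ and checkpoints $0\le n_1<n_2<\cdots$, the disturbing run $(|s_n\rangle)_{n\ge 0}$ starts in $|s_0\rangle$ and satisfies $|s_{n+1}\rangle=U_{\sigma_{n+1}}|\psi\rangle$ if $n$ is one of the checkpoints $n_i$, and $|s_{n+1}\rangle=U_{\sigma_{n+1}}|s_n\rangle$ otherwise. Put $$f^{\mathrm D}_{\mathcal A}(w)=\sup_{|\psi\rangle\in F,\ \|\psi\|=1}\ \sup_{n_1<n_2<\cdots}\ \inf_{i\ge 1}\ |\langle\psi|s_{n_i}\rangle|^2$$ (with value $0$ if $F=0$). For $\lambda\in[0,1)$ let $\mathbb L^{>\lambda}(\mathrm{QBA}|\mathrm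 D)$ be the class of all languages $\{w\in\Sigma^\omega: f^{\mathrm D}_{\mathcal A}(w)>\lambda\}$, and let $\mathbb L^{=1}(\mathrm{QBA}|\mathrm D)$ be the class of all languages $\{w\in\Sigma^\omega: f^{\mathrm D}_{\mathcal A}(w)=1\}$, where $\mathcal A$ ranges over all quantum automata over $\Sigma$. Let $\omega\text{-}\mathrm{RL}$ (respectively $\omega\text{-}\mathrm{CFL}$) be the class of all finite unions $\bigcup_{i=1}^n U_iV_i^\omega\subseteq\Sigma^\omega$ with all $U_i,V_i\subseteq\Sigma^*$ regular (respectively context-free), where $V^\omega$ is the set of infinite concatenations of nonempty words of $V$. Then: 1. for every $\lambda\in[0,1)$, $\ \omega\text{-}\mathrm{RL}\not\subseteq\mathbb L^{>\lambda}(\mathrm{QBA}|\mathrm D)$; 2. for every $\lambda\in[0,1)$, $\ \omega\text{-}\mathrm{CFL}\setminus\omega\text{-}\mathrm{RL}\not\subseteq\mathbb L^{>\lambda}(\mathrm{QBA}|\mathrm D)$; 3. $\mathbb L^{=1}(\mathrm{QBA}|\mathrm D)\not\subseteq\omega\text{-}\mathrm{RL}$. -/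

import Mathlib

/-! Infinite words over an alphabet `α` are functions `w : ℕ → α`, with letters `w 0, w 1, …`. -/

namespace OmegaLanguage

variable {α : Type*}

/-- The finite factor `w m, w (m + 1), …, w (n - 1)` of an infinite word (empty if `n ≤ m`). -/
def factor (w : ℕ → α) (m n : ℕ) : List α :=
  (List.range' m (n - m)).map w

/-- `V^ω`: the infinite words `v₀ v₁ v₂ …` with every `vᵢ ∈ V` and `vᵢ ≠ ε`. The strictly
increasing sequence `k` lists the positions at which the factors begin. -/
def omegaPower (V : Language α) : Set (ℕ → α) :=
  {w | ∃ k : ℕ → ℕ, k 0 = 0 ∧ StrictMono k ∧ ∀ i, factor w (k i) (k (i + 1)) ∈ V}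

/-- `U · L`: the infinite words `u x` with `u ∈ U` a finite word and `x ∈ L` an infinite word. -/
def concat (U : Language α) (L : Set (ℕ → α)) : Set (ℕ → α) :=
  {w | ∃ n : ℕ, factor w 0 n ∈ U ∧ (fun j => w (n + j)) ∈ L}

/-- The `ω`-Kleene closure of a class `C` of languages of finite words: all finite unions of
languages `U V^ω` with `U, V ∈ C`. -/
def omegaKleeneClosure (C : Set (Language α)) : Set (Set (ℕ → α)) :=
  {L | ∃ (n : ℕ) (U V : Fin n → Language α),
    (∀ i, U i ∈ C ∧ V i ∈ C) ∧ L = ⋃ i, concat (U i) (omegaPower (V i))}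

variable (α) in
/-- The class of `ω`-regular languages over `α`. -/
def omegaRL : Set (Set (ℕ → α)) :=
  omegaKleeneClosure {L : Language α | L.IsRegular}

variable (α) in
/-- The class of `ω`-context-free languages over `α`. -/
def omegaCFL : Set (Set (ℕ → α)) :=
  omegaKleeneClosure {L : Language α | L.IsContextFree}

end OmegaLanguage

/-- A quantum automaton over the alphabet `α` with state space `H`: an initial pure state,
a unitary operator for every letter, and a subspace of accepting states. -/
structure QuantumAutomaton (α : Type*) (H : Type*) [NormedAddCommGroup H]
    [InnerProductSpace ℂ H] where
  init : H
  norm_init : ‖init‖ = 1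
  U : α → (H ≃ₗᵢ[ℂ] H)
  F : Submodule ℂ H

namespace QuantumAutomaton

section Acceptance

variable {α H : Type*} [NormedAddCommGroup H] [InnerProductSpace ℂ H]

open Classical in
/-- The disturbing run of `A` over `w` under the measurement `{|ψ⟩⟨ψ|, I - |ψ⟩⟨ψ|}` with set of
checkpoints `{n i}`. The value at a checkpoint is the state just before the measurement there;
after the measurement the run continues from `ψ`. The letter read in step `k + 1` is `w k`. -/
noncomputable def disturbingRun (A : QuantumAutomaton α H) (w : ℕ → α) (ψ : H) (n : ℕ → ℕ) :
    ℕ → H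
  | 0 => A.init
  | k + 1 => A.U (w k) (if k ∈ Set.range n then ψ else disturbingRun A w ψ n k)

/-- The probability that `w` is disturbingly Büchi accepted by `A`: the supremum, over all pure
states (unit vectors) `ψ ∈ F` and all infinite sequences of checkpoints `n 0 < n 1 < …`, of
`inf_i |⟨ψ|s_{n i}⟩|²`. All quantities lie in `[0, 1]`, and the value is `0` if `F = 0`. -/
noncomputable def acceptProbD (A : QuantumAutomaton α H) (w : ℕ → α) : ℝ :=
  ⨆ ψ : {ψ : H // ψ ∈ A.F ∧ ‖ψ‖ = 1}, ⨆ n : {n : ℕ → ℕ // StrictMono n},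
    ⨅ i : ℕ, ‖inner ℂ ψ.1 (A.disturbingRun w ψ.1 n.1 (n.1 i))‖ ^ 2

/-- The language accepted under the strict threshold semantics with threshold `lam`. -/
def languageGT (A : QuantumAutomaton α H) (lam : ℝ) : Set (ℕ → α) :=
  {w | lam < A.acceptProbD w}

/-- The language accepted under the almost sure semantics. -/
def languageEqOne (A : QuantumAutomaton α H) : Set (ℕ → α) :=
  {w | A.acceptProbD w = 1}

end Acceptance

/-- The class of languages over `α` accepted by quantum Büchi automata (on finite-dimensional
Hilbert spaces) with disturbing acceptance under the strict threshold semantics. -/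
def classGT (α : Type*) (lam : ℝ) : Set (Set (ℕ → α)) :=
  {L | ∃ (H : Type) (_ : NormedAddCommGroup H) (_ : InnerProductSpace ℂ H)
    (_ : FiniteDimensional ℂ H) (A : QuantumAutomaton α H), L = A.languageGT lam}

/-- The class of languages over `α` accepted by quantum Büchi automata (on finite-dimensional
Hilbert spaces) with disturbing acceptance under the almost sure semantics. -/
def classEqOne (α : Type*) : Set (Set (ℕ → α)) :=
  {L | ∃ (H : Type) (_ : NormedAddCommGroup H) (_ : InnerProductSpace ℂ H)
    (_ : FiniteDimensional ℂ H) (A : QuantumAutomaton α H), L = A.languageEqOne}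

end QuantumAutomaton

/-! Parts 1 and 2 rest on recurrence. Some positive power of a unitary on a finite-dimensional space
nearly fixes any given vector. If `w` is accepted with probability above the threshold, then so is
`b^k w` for some `k > 0`: the initial state is barely disturbed, the checkpoints shift by `k`, and
the strict inequality absorbs the error (`exists_splice_mem_of_mem_classGT`). Hence no nonempty
language whose words all start with `a ≠ b` lies in the class. The witnesses are `{a^ω}` and `U U^ω`
with `U = {a^n b^n : n ≥ 1}`.

Non-regularity is always shown by counting residuals: an `ω`-regular language has finitely many, by
Myhill–Nerode applied to the `U` and `V` of each term `U V^ω` (`finite_range_residual`).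

For part 3, a two-dimensional automaton acts on an integer phase, by translation on `a` and negation
on other letters. Overlaps are cosines of integers, so by irrationality of `π` probability one
detects phase zero exactly, and `a^n b a^m b^ω` is accepted iff `n = m`. -/

namespace OmegaLanguage

/-! ### Residuals of `ω`-regular languages -/

section Words

variable {α : Type*}

/-- The infinite word consisting of the first `n` letters of `x` followed by `z`. -/
def splice (x : ℕ → α) (n : ℕ) (z : ℕ → α) : ℕ → α :=
  fun j => if j < n then x j else z (j - n)

theorem splice_of_lt {x z : ℕ → α} {n j : ℕ} (h : j < n) : splice x n z j = x j := by
  simp [splice, h]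

theorem splice_add (x z : ℕ → α) (n j : ℕ) : splice x n z (n + j) = z j := by
  simp [splice]

theorem factor_congr {w w' : ℕ → α} {m n : ℕ} (h : ∀ j, m ≤ j → j < n → w j = w' j) :
    factor w m n = factor w' m n := by
  refine List.map_congr_left fun j hj => ?_
  rw [List.mem_range'_1] at hj
  exact h j hj.1 (by omega)

theorem factor_shift (w : ℕ → α) (k m n : ℕ) :
    factor (fun j => w (k + j)) m n = factor w (k + m) (k + n) := by
  have h : k + n - (k + m) = n - m := by omega
  rw [factor, factor, h, ← List.map_add_range', List.map_map]
  rfl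

theorem factor_append (w : ℕ → α) {m n k : ℕ} (h₁ : m ≤ n) (h₂ : n ≤ k) :
    factor w m n ++ factor w n k = factor w m k := by
  have h : k - m = (n - m) + (k - n) := by omega
  have h' : n = m + 1 * (n - m) := by omega
  rw [factor, factor, factor, h, ← List.range'_append, ← h', List.map_append]

theorem factor_splice_left (x z : ℕ → α) {m n k : ℕ} (h : k ≤ n) :
    factor (splice x n z) m k = factor x m k :=
  factor_congr fun _ _ hj => splice_of_lt (hj.trans_le h)

theorem factor_splice_right (x z : ℕ → α) (n m k : ℕ) :
    factor (splice x n z) (n + m) (n + k) = factor z m k := by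
  rw [← factor_shift]
  exact congrArg (fun w => factor w m k) (funext fun j => splice_add x z n j)

theorem factor_splice_mid (x z : ℕ → α) {m n : ℕ} (k : ℕ) (h : m ≤ n) :
    factor (splice x n z) m (n + k) = factor x m n ++ factor z 0 k := by
  rw [← factor_append _ h (Nat.le_add_right n k), factor_splice_left _ _ le_rfl]
  exact congrArg _ (factor_splice_right x z n 0 k)

/-- From position `p` on, the word `w` factors into infinitely many nonempty words of `V`. -/
def FactorsFrom (V : Language α) (w : ℕ → α) (p : ℕ) : Prop :=
  ∃ k : ℕ → ℕ, k 0 = p ∧ StrictMono k ∧ ∀ i, factor w (k i) (k (i + 1)) ∈ V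

theorem FactorsFrom.cons {V : Language α} {w : ℕ → α} {p q : ℕ} (hpq : p < q)
    (hV : factor w p q ∈ V) (h : FactorsFrom V w q) : FactorsFrom V w p := by
  obtain ⟨k, rfl, hk, hkV⟩ := h
  refine ⟨fun i => i.casesOn p k, rfl, strictMono_nat_of_lt_succ ?_, ?_⟩
  · rintro (_ | i)
    · exact hpq
    · exact hk (Nat.lt_succ_self i)
  · rintro (_ | i)
    · exact hV
    · exact hkV i

theorem factorsFrom_of_strictMono {V : Language α} {w : ℕ → α} {k : ℕ → ℕ} (hk : StrictMono k)
    (hkV : ∀ i, factor w (k i) (k (i + 1)) ∈ V) (j : ℕ) : FactorsFrom V w (k j) :=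
  ⟨fun i => k (j + i), rfl, fun _ _ h => hk (by omega), fun i => hkV (j + i)⟩

theorem factorsFrom_shift {V : Language α} {w : ℕ → α} {n p : ℕ} :
    FactorsFrom V (fun j => w (n + j)) p ↔ FactorsFrom V w (n + p) := by
  constructor
  · rintro ⟨k, rfl, hk, hkV⟩
    refine ⟨fun i => n + k i, rfl, fun _ _ h => Nat.add_lt_add_left (hk h) n, fun i => ?_⟩
    rw [← factor_shift]
    exact hkV i
  · rintro ⟨k, h0, hk, hkV⟩
    have hle : ∀ i, n ≤ k i := fun i => by
      have := hk.monotone (Nat.zero_le i)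
      omega
    have hadd : ∀ i, n + (k i - n) = k i := fun i => Nat.add_sub_cancel' (hle i)
    refine ⟨fun i => k i - n, by simp [h0], fun i j h => ?_, fun i => ?_⟩
    · have := hk h
      have := hle i
      simp only
      omega
    · rw [factor_shift, hadd, hadd]
      exact hkV i

theorem factorsFrom_splice_add {V : Language α} {x z : ℕ → α} {n p : ℕ} :
    FactorsFrom V (splice x n z) (n + p) ↔ FactorsFrom V z p := by
  rw [← factorsFrom_shift]
  simp only [splice_add]

/-- Absolute positions in one fixed word replace the shifted suffix, so that cuts can be compared
with the length of a prefix. -/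
theorem mem_concat_omegaPower {U V : Language α} {w : ℕ → α} :
    w ∈ concat U (omegaPower V) ↔ ∃ p, factor w 0 p ∈ U ∧ FactorsFrom V w p :=
  exists_congr fun _ => and_congr_right fun _ => factorsFrom_shift (p := 0)

/-- Position `p` of `x` is reached by a word of `U` followed by finitely many nonempty words
of `V`. -/
inductive CutPosition (U V : Language α) (x : ℕ → α) : ℕ → Prop
  | base {p : ℕ} : factor x 0 p ∈ U → CutPosition U V x p
  | step {p q : ℕ} : CutPosition U V x p → p < q → factor x p q ∈ V → CutPosition U V x q

theorem CutPosition.mem_concat {U V : Language α} {x z : ℕ → α} {n p : ℕ}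
    (hc : CutPosition U V x p) (hp : p ≤ n) (h : FactorsFrom V (splice x n z) p) :
    splice x n z ∈ concat U (omegaPower V) := by
  induction hc with
  | base hU => exact mem_concat_omegaPower.2 ⟨_, by rwa [factor_splice_left _ _ hp], h⟩
  | step _ hlt hV ih =>
    exact ih (hlt.le.trans hp) (h.cons hlt (by rwa [factor_splice_left _ _ hp]))

/-- The residual of `U V^ω` by a finite word, as a union of languages `M V^ω` with `M` a left
quotient of `U` or `V`. -/
theorem splice_mem_concat_iff {U V : Language α} {x z : ℕ → α} {n : ℕ} :
    splice x n z ∈ concat U (omegaPower V) ↔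
      z ∈ concat (U.leftQuotient (factor x 0 n)) (omegaPower V) ∨
      ∃ p < n, CutPosition U V x p ∧
        z ∈ concat (V.leftQuotient (factor x p n)) (omegaPower V) := by
  constructor
  · intro h
    obtain ⟨_, hU, k, rfl, hk, hkV⟩ := mem_concat_omegaPower.1 h
    have hF := factorsFrom_of_strictMono hk hkV
    -- The first cut at or beyond `n` decides the case: index zero means the prefix ends within the
    -- `U`-factor, a later index that it ends within a `V`-factor begun before `n`.
    have hex : ∃ j, n ≤ k j := ⟨n, hk.le_apply⟩
    rcases hj : Nat.find hex with _ | j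
    · left
      have h0 : n ≤ k 0 := hj ▸ Nat.find_spec hex
      obtain ⟨l, hl⟩ := Nat.exists_eq_add_of_le h0
      have := hF 0
      rw [hl] at hU this
      rw [factor_splice_mid _ _ _ (Nat.zero_le n)] at hU
      exact mem_concat_omegaPower.2 ⟨l, hU, factorsFrom_splice_add.1 this⟩
    · right
      have h1 : n ≤ k (j + 1) := hj ▸ Nat.find_spec hex
      have hlt : ∀ i ≤ j, k i < n := fun i hi => by
        have := Nat.find_min hex (m := i) (by omega)
        omega
      have hcut : ∀ i ≤ j, CutPosition U V x (k i) := by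
        intro i
        induction i with
        | zero =>
          intro _
          rw [factor_splice_left _ _ (hlt 0 (Nat.zero_le j)).le] at hU
          exact .base hU
        | succ i ih =>
          intro hi
          have hV := hkV i
          rw [factor_splice_left _ _ (hlt _ hi).le] at hV
          exact .step (ih (by omega)) (hk (Nat.lt_succ_self i)) hV
      refine ⟨k j, hlt j le_rfl, hcut j le_rfl, ?_⟩
      obtain ⟨l, hl⟩ := Nat.exists_eq_add_of_le h1
      have hV := hkV j
      have := hF (j + 1)
      rw [hl] at hV this
      rw [factor_splice_mid _ _ _ (hlt j le_rfl).le] at hV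
      exact mem_concat_omegaPower.2 ⟨l, hV, factorsFrom_splice_add.1 this⟩
  · rintro (h | ⟨p, hp, hc, h⟩) <;> obtain ⟨l, hl, hF⟩ := mem_concat_omegaPower.1 h
    · refine mem_concat_omegaPower.2 ⟨n + l, ?_, factorsFrom_splice_add.2 hF⟩
      rw [factor_splice_mid _ _ _ (Nat.zero_le n)]
      exact hl
    · refine hc.mem_concat hp.le ((factorsFrom_splice_add.2 hF).cons (by omega) ?_)
      rw [factor_splice_mid _ _ _ hp.le]
      exact hl

/-- The residual of an `ω`-language by the first `n` letters of `x`. -/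
def residual (L : Set (ℕ → α)) (x : (ℕ → α) × ℕ) : Set (ℕ → α) :=
  {z | splice x.1 x.2 z ∈ L}

/-- A residual is determined by one left quotient of `U` and a set of left quotients of `V`.
Regularity leaves finitely many of either, hence finitely many such pairs. -/
theorem finite_range_residual_concat {U V : Language α} (hU : U.IsRegular) (hV : V.IsRegular) :
    (Set.range (residual (concat U (omegaPower V)))).Finite := by
  have hfin := hU.finite_range_leftQuotient.prod hV.finite_range_leftQuotient.finite_subsets
  refine (hfin.image fun T : Language α × Set (Language α) =>
    concat T.1 (omegaPower V) ∪ ⋃ M ∈ T.2, concat M (omegaPower V)).subset ?_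
  rintro _ ⟨⟨x, n⟩, rfl⟩
  refine ⟨(U.leftQuotient (factor x 0 n),
    {M | ∃ p < n, CutPosition U V x p ∧ V.leftQuotient (factor x p n) = M}),
    ⟨⟨_, rfl⟩, ?_⟩, ?_⟩
  · rintro _ ⟨p, _, _, rfl⟩
    exact ⟨_, rfl⟩
  · ext z
    simp only [residual, Set.mem_ofPred_eq, splice_mem_concat_iff, Set.mem_union, Set.mem_iUnion]
    refine or_congr Iff.rfl ⟨?_, ?_⟩
    · rintro ⟨_, ⟨p, hp, hc, rfl⟩, hz⟩
      exact ⟨p, hp, hc, hz⟩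
    · rintro ⟨p, hp, hc, hz⟩
      exact ⟨_, ⟨p, hp, hc, rfl⟩, hz⟩

/-- An `ω`-regular language has finitely many residuals. -/
theorem finite_range_residual {L : Set (ℕ → α)} (hL : L ∈ omegaRL α) :
    (Set.range (residual L)).Finite := by
  obtain ⟨n, U, V, hUV, rfl⟩ := hL
  have hfin : (Set.univ.pi fun i : Fin n =>
      Set.range (residual (concat (U i) (omegaPower (V i))))).Finite :=
    Set.Finite.pi fun i => finite_range_residual_concat (hUV i).1 (hUV i).2
  refine (hfin.image fun R => ⋃ i, R i).subset ?_
  rintro _ ⟨x, rfl⟩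
  refine ⟨fun i => residual (concat (U i) (omegaPower (V i))) x, fun i _ => ⟨x, rfl⟩, ?_⟩
  ext z
  simp [residual]

/-- A language separating infinitely many pairs of finite words is not `ω`-regular. -/
theorem notMem_omegaRL_of_separates {L : Set (ℕ → α)} (x : ℕ → (ℕ → α) × ℕ) (z : ℕ → ℕ → α)
    (h : ∀ n m, splice (x n).1 (x n).2 (z m) ∈ L ↔ n = m) : L ∉ omegaRL α := by
  intro hL
  refine Set.infinite_range_of_injective (f := fun n => residual L (x n)) (fun n m hnm => ?_)
    ((finite_range_residual hL).subset ?_)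
  · have : z m ∈ residual L (x m) := (h m m).2 rfl
    rw [← show residual L (x n) = residual L (x m) from hnm] at this
    exact (h n m).1 this
  · rintro _ ⟨n, rfl⟩
    exact ⟨x n, rfl⟩

end Words

end OmegaLanguage

namespace OmegaLanguage

/-! ### Two witness languages: `{a^ω}` and blocks `a^n b^n` -/

section Examples

variable {α : Type*}

/-- Every left quotient is empty or the singleton of a suffix of `x`. -/
theorem isRegular_singleton (x : List α) : Language.IsRegular ({x} : Language α) := by
  refine .of_finite_range_leftQuotient ?_
  refine (((List.finite_toSet x.tails).image fun y => ({y} : Set (List α))).insert ∅).subset ?_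
  rintro _ ⟨u, rfl⟩
  by_cases h : ∃ y, u ++ y = x
  · obtain ⟨y, rfl⟩ := h
    refine Or.inr ⟨y, by simp, ?_⟩
    ext v
    exact (List.append_right_inj u).symm
  · left
    ext v
    exact iff_of_false (fun hv => h ⟨v, hv⟩) id

/-- The language `{a^ω}`, as `{ε} {a}^ω`. -/
def constantWord (a : α) : Set (ℕ → α) :=
  concat ({[]} : Language α) (omegaPower ({[a]} : Language α))

theorem constantWord_mem_omegaRL (a : α) : constantWord a ∈ omegaRL α := by
  refine ⟨1, fun _ => {[]}, fun _ => {[a]},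
    fun _ => ⟨isRegular_singleton _, isRegular_singleton _⟩, ?_⟩
  exact (Set.iUnion_const _).symm

theorem factor_eq_replicate_iff {w : ℕ → α} {p n : ℕ} {c : α} :
    factor w p (p + n) = List.replicate n c ↔ ∀ i < n, w (p + i) = c := by
  rw [List.eq_replicate_iff]
  simp only [factor, List.length_map, List.length_range', List.forall_mem_map,
    List.mem_range'_1, Nat.add_sub_cancel_left, true_and]
  constructor
  · intro h i hi
    exact h _ ⟨by omega, by omega⟩
  · rintro h j ⟨h₁, h₂⟩
    obtain ⟨i, rfl⟩ := Nat.exists_eq_add_of_le h₁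
    exact h i (by omega)

theorem length_factor (w : ℕ → α) (m n : ℕ) : (factor w m n).length = n - m := by
  simp [factor]

theorem const_mem_constantWord (a : α) : (fun _ => a) ∈ constantWord a :=
  mem_concat_omegaPower.2 ⟨0, rfl, id, rfl, strictMono_id, fun _ =>
    (factor_eq_replicate_iff (n := 1)).2 fun _ _ => rfl⟩

theorem apply_zero_of_mem_constantWord {a : α} {w : ℕ → α} (h : w ∈ constantWord a) :
    w 0 = a := by
  obtain ⟨p, hp, k, rfl, hk, hkV⟩ := mem_concat_omegaPower.1 h
  have h0 : k 0 = 0 := by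
    have := congrArg List.length (show factor w 0 (k 0) = [] from hp)
    simpa [length_factor] using this
  have hV : factor w (k 0) (k 1) = [a] := hkV 0
  have h1 : k 1 = 0 + 1 := by
    have := congrArg List.length hV
    simpa [length_factor, h0] using this
  rw [h0, h1] at hV
  exact factor_eq_replicate_iff.1 hV 0 one_pos

/-- The language of all words `a^n b^n` with `n` positive. -/
def balancedBlocks (a b : α) : Language α :=
  {x | ∃ n, x = List.replicate (n + 1) a ++ List.replicate (n + 1) b}

open Classical in
/-- The grammar with the rules `S → a S b` and `S → a b`. -/
noncomputable def balancedGrammar (a b : α) : ContextFreeGrammar α where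
  NT := Unit
  initial := ()
  rules := {⟨(), [.terminal a, .nonterminal (), .terminal b]⟩,
    ⟨(), [.terminal a, .terminal b]⟩}

open Classical in
theorem mem_rules_balancedGrammar {a b : α} {r : ContextFreeRule α Unit} :
    r ∈ (balancedGrammar a b).rules ↔
      r = ⟨(), [.terminal a, .nonterminal (), .terminal b]⟩ ∨
        r = ⟨(), [.terminal a, .terminal b]⟩ :=
  Finset.mem_insert.trans (or_congr Iff.rfl Finset.mem_singleton)

theorem balancedGrammar_produces_iff {a b : α} {s t : List (Symbol α Unit)} :
    (balancedGrammar a b).Produces s t ↔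
      ∃ p q, s = p ++ .nonterminal () :: q ∧
        (t = p ++ .terminal a :: .nonterminal () :: .terminal b :: q ∨
          t = p ++ .terminal a :: .terminal b :: q) := by
  constructor
  · rintro ⟨r, hr, hst⟩
    obtain ⟨p, q, rfl, rfl⟩ := hst.exists_parts
    refine ⟨p, q, List.append_assoc _ _ _, ?_⟩
    obtain rfl | rfl := mem_rules_balancedGrammar.1 hr
    · exact Or.inl (List.append_assoc _ _ _)
    · exact Or.inr (List.append_assoc _ _ _)
  · rintro ⟨p, q, rfl, ht⟩
    have h (r : ContextFreeRule α Unit) :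
        r.Rewrites (p ++ .nonterminal r.input :: q) (p ++ (r.output ++ q)) := by
      simpa using ContextFreeRule.rewrites_of_exists_parts r p q
    obtain rfl | rfl := ht
    · exact ⟨_, mem_rules_balancedGrammar.2 (Or.inl rfl), h _⟩
    · exact ⟨_, mem_rules_balancedGrammar.2 (Or.inr rfl), h _⟩

theorem balancedGrammar_derives {a b : α} {s : List (Symbol α Unit)}
    (h : (balancedGrammar a b).Derives [.nonterminal ()] s) :
    ∃ n, s = List.replicate n (.terminal a) ++ .nonterminal () :: List.replicate n (.terminal b) ∨
      s = List.replicate (n + 1) (.terminal a) ++ List.replicate (n + 1) (.terminal b) := by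
  induction h with
  | refl => exact ⟨0, Or.inl rfl⟩
  | tail _ hst ih =>
    obtain ⟨p, q, rfl, ht⟩ := balancedGrammar_produces_iff.1 hst
    obtain ⟨n, h | h⟩ := ih
    -- The nonterminal occurs only once, so the place of rewriting is forced.
    · rw [eq_comm, List.append_cons_inj_of_notMem (by simp) (by simp)] at h
      obtain ⟨rfl, -, rfl⟩ := h
      obtain rfl | rfl := ht
      · refine ⟨n + 1, Or.inl ?_⟩
        rw [List.replicate_succ', List.replicate_succ (a := Symbol.terminal b)]
        simp
      · refine ⟨n, Or.inr ?_⟩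
        rw [List.replicate_succ', List.replicate_succ (a := Symbol.terminal b)]
        simp
    · have hmem : Symbol.nonterminal () ∈ p ++ Symbol.nonterminal () :: q := by simp
      rw [h] at hmem
      simp at hmem

theorem derives_balancedGrammar (a b : α) (n : ℕ) :
    (balancedGrammar a b).Derives [.nonterminal ()]
      (List.replicate n (.terminal a) ++ .nonterminal () :: List.replicate n (.terminal b)) := by
  induction n with
  | zero => exact Relation.ReflTransGen.refl
  | succ n ih =>
    refine ih.tail (balancedGrammar_produces_iff.2 ⟨_, _, rfl, Or.inl ?_⟩)
    rw [List.replicate_succ', List.replicate_succ (a := Symbol.terminal b)]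
    simp
    rfl

theorem balancedBlocks_isContextFree (a b : α) : (balancedBlocks a b).IsContextFree := by
  refine ⟨balancedGrammar a b, ?_⟩
  ext x
  constructor
  · intro h
    obtain ⟨n, h | h⟩ := balancedGrammar_derives (s := x.map .terminal) h
    · have hmem : (.nonterminal () : Symbol α Unit) ∈ x.map Symbol.terminal := by simp [h]
      simp at hmem
    · refine ⟨n, List.map_injective_iff.2 (fun _ _ h => Symbol.terminal.inj h) (?_ : x.map (Symbol.terminal (N := Unit)) = _)⟩
      rw [h]
      simp
  · rintro ⟨n, rfl⟩
    refine (derives_balancedGrammar a b n).tail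
      (balancedGrammar_produces_iff.2 ⟨_, _, rfl, Or.inr ?_⟩)
    rw [List.replicate_succ', List.replicate_succ (a := b)]
    simp
    rfl

theorem factor_mem_balancedBlocks_iff {w : ℕ → α} {p q : ℕ} {a b : α} :
    factor w p q ∈ balancedBlocks a b ↔ ∃ s, q = p + (s + 1) + (s + 1) ∧
      (∀ i ≤ s, w (p + i) = a) ∧ ∀ i ≤ s, w (p + (s + 1) + i) = b := by
  refine exists_congr fun s => ?_
  constructor
  · intro h
    have hq : q = p + (s + 1) + (s + 1) := by
      have := congrArg List.length h
      simp [length_factor] at this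
      omega
    subst hq
    rw [← factor_append w (n := p + (s + 1)) (by omega) (by omega)] at h
    obtain ⟨h₁, h₂⟩ := List.append_inj h (by simp [length_factor])
    rw [factor_eq_replicate_iff] at h₁ h₂
    exact ⟨rfl, fun i hi => h₁ i (by omega), fun i hi => h₂ i (by omega)⟩
  · rintro ⟨rfl, h₁, h₂⟩
    rw [← factor_append w (n := p + (s + 1)) (by omega) (by omega)]
    exact congrArg₂ _ (factor_eq_replicate_iff.2 fun i hi => h₁ i (by omega))
      (factor_eq_replicate_iff.2 fun i hi => h₂ i (by omega))

/-- The `ω`-language `U U^ω` with `U` the language of all `a^n b^n`, `n` positive. -/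
def balancedWords (a b : α) : Set (ℕ → α) :=
  concat (balancedBlocks a b) (omegaPower (balancedBlocks a b))

theorem balancedWords_mem_omegaCFL (a b : α) : balancedWords a b ∈ omegaCFL α := by
  refine ⟨1, fun _ => balancedBlocks a b, fun _ => balancedBlocks a b,
    fun _ => ⟨balancedBlocks_isContextFree a b, balancedBlocks_isContextFree a b⟩, ?_⟩
  exact (Set.iUnion_const _).symm

theorem apply_zero_of_mem_balancedWords {a b : α} {w : ℕ → α} (h : w ∈ balancedWords a b) :
    w 0 = a := by
  obtain ⟨p, hp, -⟩ := mem_concat_omegaPower.1 h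
  obtain ⟨s, -, ha, -⟩ := factor_mem_balancedBlocks_iff.1 hp
  exact ha 0 (Nat.zero_le s)

/-- The infinite word `b^(m+1) (ab)^ω`. -/
def closingWord (a b : α) (m : ℕ) : ℕ → α :=
  fun j => if j ≤ m then b else if (j - (m + 1)) % 2 = 0 then a else b

/-- In `a^(n+1) b^(m+1) (ab)^ω` the leading run of `a` forces the first factor to be `a^(n+1)
b^(n+1)`. The next factor must begin with `a`, which rules out `n < m`; the `a` after the run of `b`
rules out `n > m`. -/
theorem splice_closingWord_mem_balancedWords_iff {a b : α} (hab : a ≠ b) (n m : ℕ) :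
    splice (fun _ => a) (n + 1) (closingWord a b m) ∈ balancedWords a b ↔ n = m := by
  set w := splice (fun _ => a) (n + 1) (closingWord a b m)
  have ha : ∀ i ≤ n, w i = a := fun i hi => splice_of_lt (by omega)
  have hz : ∀ i, w (n + 1 + i) = closingWord a b m i := splice_add _ _ _
  have hb : ∀ i ≤ m, w (n + 1 + i) = b := fun i hi => by simp [hz, closingWord, hi]
  have hc : ∀ i, w (n + 1 + (m + 1 + i)) = if i % 2 = 0 then a else b := fun i => by
    rw [hz, closingWord, if_neg (by omega), Nat.add_sub_cancel_left]
  constructor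
  · intro h
    obtain ⟨p, hp, k, rfl, -, hkV⟩ := mem_concat_omegaPower.1 h
    obtain ⟨s, hs, hsa, hsb⟩ := factor_mem_balancedBlocks_iff.1 hp
    obtain ⟨t, -, hta, -⟩ := factor_mem_balancedBlocks_iff.1 (hkV 0)
    have hnext := hta 0 (Nat.zero_le t)
    rw [hs] at hnext
    have hns : n = s := by
      rcases lt_trichotomy n s with hlt | heq | hlt
      · have h₁ := hsa (n + 1) hlt
        rw [zero_add] at h₁
        exact absurd (h₁.symm.trans (hb 0 (Nat.zero_le m))) hab
      · exact heq
      · have h₁ := hsb 0 (Nat.zero_le s)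
        rw [ha _ (by omega)] at h₁
        exact absurd h₁ hab
    subst hns
    rcases lt_trichotomy n m with hlt | heq | hlt
    · have h₁ := hb (n + 1) hlt
      rw [zero_add, add_zero] at hnext
      exact absurd (hnext.symm.trans h₁) hab
    · exact heq
    · have h₁ := hsb (m + 1) hlt
      have h₂ := hc 0
      rw [zero_add] at h₁
      exact absurd (h₂.symm.trans h₁) hab
  · rintro rfl
    refine mem_concat_omegaPower.2 ⟨n + 1 + (n + 1), factor_mem_balancedBlocks_iff.2
      ⟨n, by omega, fun i hi => ha _ (by omega), fun i hi => ?_⟩,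
      fun i => n + 1 + (n + 1 + 2 * i), by simp, fun i j _ => by dsimp only; omega, fun i =>
      factor_mem_balancedBlocks_iff.2 ⟨0, by dsimp only; omega, fun j hj => ?_, fun j hj => ?_⟩⟩
    · rw [zero_add]
      exact hb i hi
    · obtain rfl : j = 0 := by omega
      have := hc (2 * i)
      rwa [if_pos (by omega)] at this
    · obtain rfl : j = 0 := by omega
      have := hc (2 * i + 1)
      rwa [if_neg (by omega)] at this

theorem balancedWords_notMem_omegaRL {a b : α} (hab : a ≠ b) : balancedWords a b ∉ omegaRL α :=
  notMem_omegaRL_of_separates (fun n => (fun _ => a, n + 1)) (closingWord a b)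
    (splice_closingWord_mem_balancedWords_iff hab)

end Examples

end OmegaLanguage

namespace QuantumAutomaton

/-! ### Disturbing runs, recurrence and pullback to time zero -/

section Runs

variable {α H : Type*} [NormedAddCommGroup H] [InnerProductSpace ℂ H]

theorem disturbingRun_succ_of_notMem (A : QuantumAutomaton α H) (w : ℕ → α) (ψ : H) {n : ℕ → ℕ}
    {k : ℕ} (h : k ∉ Set.range n) :
    A.disturbingRun w ψ n (k + 1) = A.U (w k) (A.disturbingRun w ψ n k) := by
  rw [disturbingRun, if_neg h]

theorem disturbingRun_succ_of_mem (A : QuantumAutomaton α H) (w : ℕ → α) (ψ : H) {n : ℕ → ℕ}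
    {k : ℕ} (h : k ∈ Set.range n) :
    A.disturbingRun w ψ n (k + 1) = A.U (w k) ψ := by
  rw [disturbingRun, if_pos h]

theorem norm_disturbingRun (A : QuantumAutomaton α H) (w : ℕ → α) {ψ : H} (hψ : ‖ψ‖ = 1)
    (n : ℕ → ℕ) (k : ℕ) : ‖A.disturbingRun w ψ n k‖ = 1 := by
  induction k with
  | zero => exact A.norm_init
  | succ k ih =>
    by_cases h : k ∈ Set.range n
    · rw [disturbingRun_succ_of_mem A w ψ h, LinearIsometryEquiv.norm_map, hψ]
    · rw [disturbingRun_succ_of_notMem A w ψ h, LinearIsometryEquiv.norm_map, ih]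

theorem norm_inner_sq_le_one {x y : H} (hx : ‖x‖ = 1) (hy : ‖y‖ = 1) :
    ‖inner ℂ x y‖ ^ 2 ≤ 1 := by
  refine pow_le_one₀ (norm_nonneg _) ?_
  simpa [hx, hy] using norm_inner_le_norm (𝕜 := ℂ) x y

instance : Nonempty {n : ℕ → ℕ // StrictMono n} := ⟨⟨id, strictMono_id⟩⟩

theorem bddBelow_overlap (A : QuantumAutomaton α H) (w : ℕ → α) (ψ : H) (n : ℕ → ℕ) :
    BddBelow (Set.range fun i => ‖inner ℂ ψ (A.disturbingRun w ψ n (n i))‖ ^ 2) :=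
  ⟨0, by rintro _ ⟨i, rfl⟩; positivity⟩

theorem iInf_overlap_le_one (A : QuantumAutomaton α H) (w : ℕ → α) {ψ : H} (hψ : ‖ψ‖ = 1)
    (n : ℕ → ℕ) : ⨅ i : ℕ, ‖inner ℂ ψ (A.disturbingRun w ψ n (n i))‖ ^ 2 ≤ 1 :=
  (ciInf_le (bddBelow_overlap A w ψ n) 0).trans
    (norm_inner_sq_le_one hψ (norm_disturbingRun A w hψ _ _))

theorem iSup_checkpoints_le_one (A : QuantumAutomaton α H) (w : ℕ → α) {ψ : H} (hψ : ‖ψ‖ = 1) :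
    ⨆ n : {n : ℕ → ℕ // StrictMono n},
      ⨅ i : ℕ, ‖inner ℂ ψ (A.disturbingRun w ψ n.1 (n.1 i))‖ ^ 2 ≤ 1 :=
  ciSup_le fun n => iInf_overlap_le_one A w hψ n.1

theorem acceptProbD_le_one (A : QuantumAutomaton α H) (w : ℕ → α) : A.acceptProbD w ≤ 1 :=
  Real.iSup_le (fun ψ => iSup_checkpoints_le_one A w ψ.2.2) zero_le_one

theorem le_acceptProbD (A : QuantumAutomaton α H) {w : ℕ → α} {ψ : H} (hF : ψ ∈ A.F)
    (hψ : ‖ψ‖ = 1) {n : ℕ → ℕ} (hn : StrictMono n) {c : ℝ}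
    (hc : ∀ i, c ≤ ‖inner ℂ ψ (A.disturbingRun w ψ n (n i))‖ ^ 2) : c ≤ A.acceptProbD w := by
  refine le_ciSup_of_le ⟨1, ?_⟩ ⟨ψ, hF, hψ⟩ (le_ciSup_of_le ⟨1, ?_⟩ ⟨n, hn⟩ (le_ciInf hc))
  · rintro _ ⟨φ, rfl⟩
    exact iSup_checkpoints_le_one A w φ.2.2
  · rintro _ ⟨m, rfl⟩
    exact iInf_overlap_le_one A w hψ m.1

theorem exists_of_lt_acceptProbD (A : QuantumAutomaton α H) {w : ℕ → α} {lam : ℝ}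
    (h0 : 0 ≤ lam) (h : lam < A.acceptProbD w) :
    ∃ ψ ∈ A.F, ‖ψ‖ = 1 ∧ ∃ n : ℕ → ℕ, StrictMono n ∧ ∃ c, lam < c ∧
      ∀ i, c ≤ ‖inner ℂ ψ (A.disturbingRun w ψ n (n i))‖ ^ 2 := by
  rcases isEmpty_or_nonempty {ψ : H // ψ ∈ A.F ∧ ‖ψ‖ = 1} with hE | hE
  -- With no unit vector in `F`, the real supremum takes its default value `0`, which cannot exceed
  -- `lam`.
  · rw [acceptProbD, Real.iSup_of_isEmpty] at h
    exact absurd h h0.not_gt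
  · obtain ⟨ψ, hψ⟩ := exists_lt_of_lt_ciSup h
    obtain ⟨n, hn⟩ := exists_lt_of_lt_ciSup hψ
    exact ⟨ψ.1, ψ.2.1, ψ.2.2, n.1, n.2, _, hn, ciInf_le (bddBelow_overlap A w ψ.1 n.1)⟩

/-- Powers of an isometry of a finite-dimensional space return close to the identity on a given
vector. -/
theorem exists_norm_iterate_sub_lt [FiniteDimensional ℂ H] (T : H ≃ₗᵢ[ℂ] H) (x : H) {ε : ℝ}
    (hε : 0 < ε) : ∃ k, 0 < k ∧ ‖T^[k] x - x‖ < ε := by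
  have hnorm : ∀ k y, ‖T^[k] y‖ = ‖y‖ := fun k => by
    induction k with
    | zero => exact fun _ => rfl
    | succ k ih => exact fun y => (ih (T y)).trans (T.norm_map y)
  have hsub : ∀ k y z, T^[k] y - T^[k] z = T^[k] (y - z) := fun k => by
    induction k with
    | zero => exact fun _ _ => rfl
    | succ k ih => exact fun y z => (ih (T y) (T z)).trans (by rw [← map_sub]; rfl)
  -- The orbit stays in a compact ball, so two of its terms are close; cancelling the common power
  -- of the isometry brings the earlier term back to `x`.
  have := FiniteDimensional.proper ℂ H
  obtain ⟨_, -, φ, hφ, hlim⟩ := (isCompact_closedBall (0 : H) ‖x‖).tendsto_subseq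
    (x := fun k => T^[k] x) (fun k => by simp [hnorm])
  obtain ⟨N, hN⟩ := Metric.cauchySeq_iff.1 hlim.cauchySeq ε hε
  have hlt := hφ (Nat.lt_succ_self N)
  refine ⟨φ (N + 1) - φ N, Nat.sub_pos_of_lt hlt, ?_⟩
  have h := hN (N + 1) (Nat.le_succ N) N le_rfl
  simp only [Function.comp_apply] at h
  rwa [dist_eq_norm, ← Nat.add_sub_cancel' hlt.le, Function.iterate_add_apply, hsub, hnorm] at h

theorem disturbingRun_of_le (A : QuantumAutomaton α H) (b : α) (w : ℕ → α) (ψ : H) (n : ℕ → ℕ)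
    (k : ℕ) {j : ℕ} (hj : j ≤ k) :
    A.disturbingRun (OmegaLanguage.splice (fun _ => b) k w) ψ (fun i => k + n i) j =
      (A.U b)^[j] A.init := by
  induction j with
  | zero => rfl
  | succ j ih =>
    rw [disturbingRun_succ_of_notMem, ih (by omega), OmegaLanguage.splice_of_lt (by omega),
      Function.iterate_succ_apply']
    rintro ⟨i, hi⟩
    simp only at hi
    omega

/-- Unitary steps preserve the distance between the two runs, and a checkpoint resets both to `ψ`,
so the initial error never grows. -/
theorem norm_disturbingRun_splice_sub_le (A : QuantumAutomaton α H) (b : α) (w : ℕ → α) (ψ : H)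
    (n : ℕ → ℕ) {k : ℕ} {ε : ℝ} (hk : ‖(A.U b)^[k] A.init - A.init‖ ≤ ε) (j : ℕ) :
    ‖A.disturbingRun (OmegaLanguage.splice (fun _ => b) k w) ψ (fun i => k + n i) (k + j) -
      A.disturbingRun w ψ n j‖ ≤ ε := by
  induction j with
  | zero => rwa [add_zero, disturbingRun_of_le _ _ _ _ _ _ le_rfl]
  | succ j ih =>
    have hmem : k + j ∈ Set.range (fun i => k + n i) ↔ j ∈ Set.range n := by simp
    rw [← add_assoc]
    by_cases h : j ∈ Set.range n
    · rw [disturbingRun_succ_of_mem _ _ _ h, disturbingRun_succ_of_mem _ _ _ (hmem.2 h),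
        OmegaLanguage.splice_add, sub_self, norm_zero]
      exact (norm_nonneg _).trans hk
    · rwa [disturbingRun_succ_of_notMem _ _ _ h, disturbingRun_succ_of_notMem _ _ _ (mt hmem.1 h),
        OmegaLanguage.splice_add, ← map_sub, LinearIsometryEquiv.norm_map]

/-- Factor the difference of squares: the sum of the two moduli is at most `2`. -/
theorem norm_inner_sq_sub_le {ψ x y : H} (hψ : ‖ψ‖ = 1) (hx : ‖x‖ = 1) (hy : ‖y‖ = 1) :
    ‖inner ℂ ψ x‖ ^ 2 - ‖inner ℂ ψ y‖ ^ 2 ≤ 2 * ‖y - x‖ := by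
  have h₁ : ‖inner ℂ ψ x‖ - ‖inner ℂ ψ y‖ ≤ ‖y - x‖ := by
    refine (norm_sub_norm_le _ _).trans ?_
    rw [← inner_sub_right, norm_sub_rev y x]
    simpa [hψ] using norm_inner_le_norm (𝕜 := ℂ) ψ (x - y)
  have h₂ : ‖inner ℂ ψ x‖ ≤ 1 := by simpa [hψ, hx] using norm_inner_le_norm (𝕜 := ℂ) ψ x
  have h₃ : ‖inner ℂ ψ y‖ ≤ 1 := by simpa [hψ, hy] using norm_inner_le_norm (𝕜 := ℂ) ψ y
  nlinarith [norm_nonneg (inner ℂ ψ x), norm_nonneg (inner ℂ ψ y), norm_nonneg (y - x)]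

/-- Every language in the strict threshold class is closed under prepending some positive power
of a given letter to a given word. -/
theorem exists_splice_mem_of_mem_classGT {lam : ℝ} (h0 : 0 ≤ lam) {L : Set (ℕ → α)}
    (hL : L ∈ classGT α lam) {w : ℕ → α} (hw : w ∈ L) (b : α) :
    ∃ k, 0 < k ∧ OmegaLanguage.splice (fun _ => b) k w ∈ L := by
  obtain ⟨H, _, _, _, A, rfl⟩ := hL
  obtain ⟨ψ, hF, hψ, n, hn, c, hc, hov⟩ := A.exists_of_lt_acceptProbD h0 hw
  obtain ⟨k, hk, hlt⟩ := exists_norm_iterate_sub_lt (A.U b) A.init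
    -- Overlaps change by at most twice the error, so at least `c - (c - lam) / 2 = (c + lam) / 2 >
    -- lam` remains.
    (show 0 < (c - lam) / 4 by linarith)
  refine ⟨k, hk, lt_of_lt_of_le (show lam < (c + lam) / 2 by linarith)
    (A.le_acceptProbD hF hψ (n := fun i => k + n i)
      (fun _ _ h => Nat.add_lt_add_left (hn h) k) fun i => ?_)⟩
  have h₁ := A.norm_disturbingRun_splice_sub_le b w ψ n hlt.le (n i)
  have h₂ := norm_inner_sq_sub_le hψ (A.norm_disturbingRun w hψ n (n i))
    (A.norm_disturbingRun (OmegaLanguage.splice (fun _ => b) k w) hψ (fun i => k + n i) (k + n i))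
  linarith [hov i]

theorem notMem_classGT_of_first_letter {lam : ℝ} (h0 : 0 ≤ lam) {a b : α} (hab : a ≠ b)
    {L : Set (ℕ → α)} {w : ℕ → α} (hw : w ∈ L) (hL : ∀ x ∈ L, x 0 = a) : L ∉ classGT α lam := by
  intro h
  obtain ⟨k, hk, hmem⟩ := exists_splice_mem_of_mem_classGT h0 h hw b
  exact hab ((hL _ hmem).symm.trans (OmegaLanguage.splice_of_lt hk))

/-- The inverse of the evolution along the first `k` letters of `w`. -/
noncomputable def pullback (A : QuantumAutomaton α H) (w : ℕ → α) : ℕ → (H ≃ₗᵢ[ℂ] H)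
  | 0 => .refl ℂ H
  | k + 1 => (A.U (w k)).symm.trans (A.pullback w k)

theorem pullback_succ_apply (A : QuantumAutomaton α H) (w : ℕ → α) (k : ℕ) (x : H) :
    A.pullback w (k + 1) x = A.pullback w k ((A.U (w k)).symm x) := rfl

theorem pullback_disturbingRun_of_le (A : QuantumAutomaton α H) (w : ℕ → α) (ψ : H) {n : ℕ → ℕ}
    (hn : StrictMono n) {k : ℕ} (hk : k ≤ n 0) :
    A.pullback w k (A.disturbingRun w ψ n k) = A.init := by
  induction k with
  | zero => rfl
  | succ k ih =>
    rw [disturbingRun_succ_of_notMem, pullback_succ_apply, LinearIsometryEquiv.symm_apply_apply,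
      ih (by omega)]
    rintro ⟨i, rfl⟩
    have := hn.monotone (Nat.zero_le i)
    omega

/-- Seen from time zero, the run is constant between consecutive checkpoints. Each overlap thus
compares two pullbacks of `ψ`. -/
theorem pullback_disturbingRun (A : QuantumAutomaton α H) (w : ℕ → α) (ψ : H) {n : ℕ → ℕ}
    (hn : StrictMono n) (i : ℕ) {k : ℕ} (hk : n i < k) (hk' : k ≤ n (i + 1)) :
    A.pullback w k (A.disturbingRun w ψ n k) = A.pullback w (n i) ψ := by
  induction k, Nat.succ_le_of_lt hk using Nat.le_induction with
  | base =>
    rw [Nat.succ_eq_add_one, disturbingRun_succ_of_mem _ _ _ ⟨i, rfl⟩, pullback_succ_apply,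
      LinearIsometryEquiv.symm_apply_apply]
  | succ k hle ih =>
    rw [disturbingRun_succ_of_notMem, pullback_succ_apply, LinearIsometryEquiv.symm_apply_apply,
      ih (by omega) (by omega)]
    rintro ⟨j, rfl⟩
    have h₁ : i < j := hn.lt_iff_lt.1 (by omega)
    have h₂ : j < i + 1 := hn.lt_iff_lt.1 (by omega)
    omega

end Runs

end QuantumAutomaton

namespace QuantumAutomaton

/-! ### The phase automaton and almost sure acceptance -/

section Dihedral

variable {α : Type*}

/-- The unit vector `(e^{i x}, e^{-i x}) / √2`. -/
noncomputable def phaseVector (x : ℤ) : EuclideanSpace ℂ (Fin 2) :=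
  !₂[Complex.exp (x * Complex.I) / (√2 : ℝ), Complex.exp (-x * Complex.I) / (√2 : ℝ)]

theorem inner_phaseVector (x y : ℤ) :
    inner ℂ (phaseVector x) (phaseVector y) = (Real.cos ((y - x : ℤ) : ℝ) : ℂ) := by
  have h2 : ((√2 : ℝ) : ℂ) * ((√2 : ℝ) : ℂ) = 2 := by
    rw [← Complex.ofReal_mul, Real.mul_self_sqrt zero_le_two, Complex.ofReal_ofNat]
  have h2' : ((√2 : ℝ) : ℂ) ≠ 0 := by simp
  have e₁ : ((y - x : ℤ) : ℂ) * Complex.I = y * Complex.I + -(x * Complex.I) := by push_cast; ring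
  have e₂ : -((y - x : ℤ) : ℂ) * Complex.I = -y * Complex.I + x * Complex.I := by push_cast; ring
  have c₁ : (starRingEnd ℂ) (Complex.exp (x * Complex.I)) = Complex.exp (-(x * Complex.I)) := by
    rw [← Complex.exp_conj]
    simp
  have c₂ : (starRingEnd ℂ) (Complex.exp (-(x * Complex.I))) = Complex.exp (x * Complex.I) := by
    rw [← Complex.exp_conj]
    simp
  rw [Complex.ofReal_cos, Complex.cos, Complex.ofReal_intCast, e₁, e₂, Complex.exp_add,
    Complex.exp_add]
  simp only [phaseVector, PiLp.inner_apply, Fin.sum_univ_two, RCLike.inner_apply]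
  simp [c₁, c₂]
  field_simp
  rw [sq, h2]
  ring

theorem norm_phaseVector (x : ℤ) : ‖phaseVector x‖ = 1 := by
  refine (pow_eq_one_iff_of_nonneg (norm_nonneg _) two_ne_zero).1 ?_
  rw [← inner_self_eq_norm_sq (𝕜 := ℂ), inner_phaseVector, sub_self, Int.cast_zero, Real.cos_zero]
  simp

/-- The unitary operator `diag (e^{i}, e^{-i})`. -/
noncomputable def phaseShift : EuclideanSpace ℂ (Fin 2) ≃ₗᵢ[ℂ] EuclideanSpace ℂ (Fin 2) where
  toFun v := !₂[Complex.exp Complex.I * v 0, Complex.exp (-Complex.I) * v 1]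
  invFun v := !₂[Complex.exp (-Complex.I) * v 0, Complex.exp Complex.I * v 1]
  map_add' v v' := by ext i; fin_cases i <;> simp [mul_add]
  map_smul' c v := by ext i; fin_cases i <;> simp [mul_left_comm]
  left_inv v := by ext i; fin_cases i <;> simp [← mul_assoc, ← Complex.exp_add]
  right_inv v := by ext i; fin_cases i <;> simp [← mul_assoc, ← Complex.exp_add]
  norm_map' v := by simp [EuclideanSpace.norm_eq, Complex.norm_exp]

theorem phaseShift_phaseVector (x : ℤ) : phaseShift (phaseVector x) = phaseVector (x + 1) := by
  ext i
  fin_cases i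
  · simp [phaseShift, phaseVector, add_mul, Complex.exp_add]
    ring
  · simp [phaseShift, phaseVector, add_mul, Complex.exp_add]
    ring

/-- The unitary operator exchanging the two coordinates. -/
noncomputable def coordinateSwap : EuclideanSpace ℂ (Fin 2) ≃ₗᵢ[ℂ] EuclideanSpace ℂ (Fin 2) :=
  LinearIsometryEquiv.piLpCongrLeft 2 ℂ ℂ (Equiv.swap 0 1)

theorem coordinateSwap_phaseVector (x : ℤ) :
    coordinateSwap (phaseVector x) = phaseVector (-x) := by
  ext i
  fin_cases i <;>
    simp [coordinateSwap, phaseVector, LinearIsometryEquiv.piLpCongrLeft_apply,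
      Equiv.piCongrLeft']

open Classical in
/-- The automaton that shifts the phase on the letter `a`, exchanges the coordinates on every
other letter, and starts in its unique accepting state. -/
noncomputable def dihedralAutomaton (a : α) : QuantumAutomaton α (EuclideanSpace ℂ (Fin 2)) where
  init := phaseVector 0
  norm_init := norm_phaseVector 0
  U σ := if σ = a then phaseShift else coordinateSwap
  F := Submodule.span ℂ {phaseVector 0}

open Classical in
/-- The phase of the pullback along the first letters of `w`, as a function of the phase. -/
noncomputable def pullbackPhase (a : α) (w : ℕ → α) : ℕ → ℤ → ℤ
  | 0, x => x
  | k + 1, x => pullbackPhase a w k (if w k = a then x - 1 else -x)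

theorem pullback_phaseVector (a : α) (w : ℕ → α) (k : ℕ) (x : ℤ) :
    (dihedralAutomaton a).pullback w k (phaseVector x) = phaseVector (pullbackPhase a w k x) := by
  induction k generalizing x with
  | zero => rfl
  | succ k ih =>
    rw [pullback_succ_apply, pullbackPhase, ← ih]
    congr 1
    rw [LinearIsometryEquiv.symm_apply_eq]
    simp only [dihedralAutomaton]
    split_ifs
    · rw [phaseShift_phaseVector, sub_add_cancel]
    · rw [coordinateSwap_phaseVector, neg_neg]

theorem abs_pullbackPhase_le (a : α) (w : ℕ → α) (k : ℕ) (x : ℤ) :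
    |pullbackPhase a w k x| ≤ |x| + k := by
  induction k generalizing x with
  | zero => simp [pullbackPhase]
  | succ k ih =>
    rw [pullbackPhase]
    refine (ih _).trans ?_
    push_cast
    split_ifs
    · have := abs_sub x 1
      rw [abs_one] at this
      linarith
    · rw [abs_neg]
      linarith

/-- Equality would make a nonzero integer a multiple of the irrational `π`. -/
theorem cos_intCast_sq_lt_one {x : ℤ} (hx : x ≠ 0) : Real.cos x ^ 2 < 1 := by
  refine lt_of_le_of_ne (Real.cos_sq_le_one _) fun h => ?_
  have hs : Real.sin x = 0 := by
    have := Real.sin_sq_add_cos_sq (x : ℝ)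
    rw [h] at this
    exact pow_eq_zero_iff two_ne_zero |>.1 (by linarith)
  obtain ⟨n, hn⟩ := Real.sin_eq_zero_iff.1 hs
  have hn0 : n ≠ 0 := by
    rintro rfl
    rw [Int.cast_zero, zero_mul] at hn
    exact hx (by exact_mod_cast hn.symm)
  exact (irrational_pi.intCast_mul hn0).ne_int x hn

/-- The acceptance probability is a supremum that need not be attained, so a uniform gap below `1`
is needed; for bounded phases only finitely many cosines compete. -/
theorem exists_cos_intCast_sq_le (N : ℕ) :
    ∃ c, 0 ≤ c ∧ c < 1 ∧ ∀ x : ℤ, x ≠ 0 → |x| ≤ N → Real.cos x ^ 2 ≤ c := by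
  induction N with
  | zero => exact ⟨0, le_rfl, one_pos, fun x hx h => absurd (abs_nonpos_iff.1 (by simpa using h)) hx⟩
  | succ N ih =>
    obtain ⟨c, h0, h1, hc⟩ := ih
    refine ⟨max c (Real.cos ((N + 1 : ℕ) : ℤ) ^ 2), le_max_of_le_left h0,
      max_lt h1 (cos_intCast_sq_lt_one (by omega)), fun x hx hle => ?_⟩
    rcases hle.lt_or_eq with hlt | heq
    · exact le_max_of_le_left (hc x hx (by omega))
    · refine le_max_of_le_right (le_of_eq ?_)
      rw [← heq, Int.cast_abs, Real.cos_abs]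

theorem inner_disturbingRun {H : Type*} [NormedAddCommGroup H] [InnerProductSpace ℂ H]
    (A : QuantumAutomaton α H) (w : ℕ → α) (ψ : H) (n : ℕ → ℕ) (k : ℕ) :
    inner ℂ ψ (A.disturbingRun w ψ n k) =
      inner ℂ (A.pullback w k ψ) (A.pullback w k (A.disturbingRun w ψ n k)) :=
  ((A.pullback w k).inner_map_map _ _).symm

theorem overlap_zero_dihedralAutomaton (a : α) (w : ℕ → α) {u : ℂ} (hu : ‖u‖ = 1) {n : ℕ → ℕ}
    (hn : StrictMono n) :
    ‖inner ℂ (u • phaseVector 0)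
      ((dihedralAutomaton a).disturbingRun w (u • phaseVector 0) n (n 0))‖ ^ 2 =
      Real.cos (pullbackPhase a w (n 0) 0) ^ 2 := by
  rw [inner_disturbingRun, pullback_disturbingRun_of_le _ _ _ hn le_rfl, map_smul,
    pullback_phaseVector, inner_smul_left]
  simp only [dihedralAutomaton]
  rw [inner_phaseVector, zero_sub, Int.cast_neg, Real.cos_neg]
  simp [hu, -Complex.ofReal_cos]

theorem overlap_succ_dihedralAutomaton (a : α) (w : ℕ → α) {u : ℂ} (hu : ‖u‖ = 1) {n : ℕ → ℕ}
    (hn : StrictMono n) (i : ℕ) :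
    ‖inner ℂ (u • phaseVector 0)
      ((dihedralAutomaton a).disturbingRun w (u • phaseVector 0) n (n (i + 1)))‖ ^ 2 =
      Real.cos ((pullbackPhase a w (n i) 0 - pullbackPhase a w (n (i + 1)) 0 : ℤ) : ℝ) ^ 2 := by
  rw [inner_disturbingRun, pullback_disturbingRun _ _ _ hn i (hn (Nat.lt_succ_self i)) le_rfl,
    map_smul, map_smul, pullback_phaseVector, pullback_phaseVector, inner_smul_left,
    inner_smul_right, inner_phaseVector]
  simp [hu, -Complex.ofReal_cos, -Int.cast_sub]

/-- A word whose phases are eventually constant is accepted almost surely if and only if the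
limit phase is zero. -/
theorem mem_languageEqOne_dihedralAutomaton_iff {a : α} {w : ℕ → α} {N : ℕ} {d : ℤ}
    (hd : ∀ k, N ≤ k → pullbackPhase a w k 0 = d) :
    w ∈ (dihedralAutomaton a).languageEqOne ↔ d = 0 := by
  constructor
  · intro h
    obtain ⟨c, h0, h1, hc⟩ := exists_cos_intCast_sq_le (N + N)
    have hbound : ∀ k, |pullbackPhase a w k 0| ≤ N := fun k => by
      rcases le_total N k with hk | hk
      · rw [hd k hk, ← hd N le_rfl]
        simpa using abs_pullbackPhase_le a w N 0
      · have := abs_pullbackPhase_le a w k 0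
        rw [abs_zero] at this
        omega
    -- Probability one beats `c`, so a single choice of state and checkpoints has all overlaps above
    -- `c`; inductively, every checkpoint then has phase exactly zero.
    obtain ⟨ψ, hF, hψ, n, hn, c', hc', hov⟩ :=
      (dihedralAutomaton a).exists_of_lt_acceptProbD h0 (h1.trans_eq (Eq.symm h))
    obtain ⟨u, rfl⟩ := Submodule.mem_span_singleton.1 hF
    have hu : ‖u‖ = 1 := by rwa [norm_smul, norm_phaseVector, mul_one] at hψ
    have hzero : ∀ i, pullbackPhase a w (n i) 0 = 0 := by
      intro i
      induction i with
      | zero =>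
        by_contra hne
        have h₁ := hov 0
        rw [overlap_zero_dihedralAutomaton a w hu hn] at h₁
        have h₂ := hc _ hne ((hbound _).trans (by omega))
        linarith
      | succ i ih =>
        by_contra hne
        have h₁ := hov (i + 1)
        rw [overlap_succ_dihedralAutomaton a w hu hn, ih, zero_sub, Int.cast_neg,
          Real.cos_neg] at h₁
        have h₂ := hc _ hne ((hbound _).trans (by omega))
        linarith
    -- Checkpoint number `N` lies at or beyond position `N`, where the phase is already `d`.
    rw [← hd _ hn.le_apply, hzero]
  · rintro rfl
    refine le_antisymm (acceptProbD_le_one _ _) ?_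
    have hn : StrictMono fun i => N + i := fun _ _ h => Nat.add_lt_add_left h N
    refine le_acceptProbD _ (ψ := (1 : ℂ) • phaseVector 0)
      (Submodule.smul_mem _ _ (Submodule.mem_span_singleton_self _))
      (by rw [one_smul, norm_phaseVector]) hn fun i => ?_
    cases i with
    | zero =>
      rw [overlap_zero_dihedralAutomaton a w norm_one hn, hd _ (Nat.le_add_right _ _)]
      simp
    | succ i =>
      rw [overlap_succ_dihedralAutomaton a w norm_one hn, hd _ (Nat.le_add_right _ _),
        hd _ (Nat.le_add_right _ _)]
      simp

/-- The infinite word `b a^m b^ω`. -/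
def returningWord (a b : α) (m : ℕ) : ℕ → α :=
  fun j => if j = 0 then b else if j ≤ m then a else b

/-- On `a^n b a^m b^ω` the final letters `b` fix phase zero, and pulling back through `a^m`, `b` and
`a^n` gives `-m`, `m` and `m - n`, the eventual phase. -/
theorem splice_returningWord_mem_iff {a b : α} (hab : a ≠ b) (n m : ℕ) :
    OmegaLanguage.splice (fun _ => a) n (returningWord a b m) ∈
      (dihedralAutomaton a).languageEqOne ↔ n = m := by
  set w := OmegaLanguage.splice (fun _ => a) n (returningWord a b m)
  have hz : ∀ i, w (n + i) = returningWord a b m i := OmegaLanguage.splice_add _ _ _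
  have h₁ : ∀ k ≤ n, ∀ x, pullbackPhase a w k x = x - k := by
    intro k
    induction k with
    | zero => simp [pullbackPhase]
    | succ k ih =>
      intro hk x
      rw [pullbackPhase, if_pos (OmegaLanguage.splice_of_lt (by omega)), ih (by omega)]
      push_cast
      ring
  have h₂ : ∀ k ≤ m, ∀ x, pullbackPhase a w (n + 1 + k) x = k - x - n := by
    intro k
    induction k with
    | zero =>
      intro _ x
      have hb : w n = b := hz 0
      rw [add_zero, pullbackPhase, hb, if_neg hab.symm, h₁ n le_rfl]
      simp
    | succ k ih =>
      intro hk x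
      have ha : w (n + 1 + k) = a := by
        rw [add_assoc, hz, returningWord, if_neg (by omega), if_pos (by omega)]
      rw [← add_assoc, pullbackPhase, if_pos ha, ih (by omega)]
      push_cast
      ring
  have h₃ : ∀ k, pullbackPhase a w (n + 1 + m + k) 0 = m - n := by
    intro k
    induction k with
    | zero => simp [h₂ m le_rfl]
    | succ k ih =>
      have hb : w (n + 1 + m + k) = b := by
        rw [add_assoc, add_assoc, hz, returningWord, if_neg (by omega), if_neg (by omega)]
      rw [← add_assoc, pullbackPhase, hb, if_neg hab.symm, neg_zero, ih]
  rw [mem_languageEqOne_dihedralAutomaton_iff (N := n + 1 + m) (d := m - n) fun k hk => by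
    obtain ⟨l, rfl⟩ := Nat.exists_eq_add_of_le hk
    exact h₃ l]
  omega

theorem languageEqOne_dihedralAutomaton_notMem_omegaRL {a b : α} (hab : a ≠ b) :
    (dihedralAutomaton a).languageEqOne ∉ OmegaLanguage.omegaRL α :=
  OmegaLanguage.notMem_omegaRL_of_separates (fun n => (fun _ => a, n)) (returningWord a b)
    (splice_returningWord_mem_iff hab)

end Dihedral

end QuantumAutomaton

theorem mainTheorem8 (α : Type*) [Finite α] [Nontrivial α] :
    (∀ lam : ℝ, 0 ≤ lam → lam < 1 →
      ¬ (OmegaLanguage.omegaRL α ⊆ QuantumAutomaton.classGT α lam)) ∧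
    (∀ lam : ℝ, 0 ≤ lam → lam < 1 →
      ¬ (OmegaLanguage.omegaCFL α \ OmegaLanguage.omegaRL α ⊆
        QuantumAutomaton.classGT α lam)) ∧
    ¬ (QuantumAutomaton.classEqOne α ⊆ OmegaLanguage.omegaRL α) := by
  obtain ⟨a, b, hab⟩ := exists_pair_ne α
  refine ⟨fun lam h0 _ h => ?_, fun lam h0 _ h => ?_, fun h => ?_⟩
  · exact QuantumAutomaton.notMem_classGT_of_first_letter h0 hab
      (OmegaLanguage.const_mem_constantWord a)
      (fun _ => OmegaLanguage.apply_zero_of_mem_constantWord)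
      (h (OmegaLanguage.constantWord_mem_omegaRL a))
  · exact QuantumAutomaton.notMem_classGT_of_first_letter h0 hab
      ((OmegaLanguage.splice_closingWord_mem_balancedWords_iff hab 0 0).2 rfl)
      (fun _ => OmegaLanguage.apply_zero_of_mem_balancedWords)
      (h ⟨OmegaLanguage.balancedWords_mem_omegaCFL a b,
        OmegaLanguage.balancedWords_notMem_omegaRL hab⟩)
  · exact QuantumAutomaton.languageEqOne_dihedralAutomaton_notMem_omegaRL hab
      (h ⟨_, _, _, inferInstance, _, rfl⟩)
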